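/- For an immersion $f:X\to\mathbb R^N$ of a smooth manifold, let $\mathrm{curv}^\perp_f(X)$ denote the supremum of the curvatures, measured in $\mathbb R^N$, of the curves $f\circ\gamma$, where $\gamma$ runs over the geodesics of $X$ for the Riemannian metric induced by $f$. Let $B^N(1)\subset\mathbb R^N$ be the closed unit ball. Let $k,l$ be integers with $l\ge 1$ and $k\ge l^{(l^4)}$, and let $$X=S^k\times\underbrace{S^1\times\dots\times S^1}_{l-1}.$$ Then there exists a smooth immersion $F:X\to\mathbb R^{k+l}$ with $F(X)\subset B^{k+l}(1)$ (so $F$ has codimension one) such that $$\mathrm{curv}^\perp_F(X)\le 1+2\sqrt{\frac{3l-3}{l+1}},$$ and $1+2\sqrt{\frac{3l-3}{l+1}}<4.5$. -/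

import Mathlib

open scoped Manifold ContDiff ENNReal

noncomputable section

/-- The `m`-fold product `S¹ × ⋯ × S¹` of circles. -/
abbrev Torus (m : ℕ) : Type := Fin m → Circle

/-- The model with corners of the product manifold `S¹ × ⋯ × S¹` (`m` factors). -/
abbrev torusModel (m : ℕ) :
    ModelWithCorners ℝ (Fin m → EuclideanSpace ℝ (Fin 1))
      (ModelPi fun _ : Fin m => EuclideanSpace ℝ (Fin 1)) :=
  ModelWithCorners.pi fun _ : Fin m => 𝓡 1

/-- The product of circles, with this model, is a smooth manifold. -/
instance torus_isManifold (m : ℕ) : IsManifold (torusModel m) ∞ (Torus m) := by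
  apply isManifold_of_contDiffOn
  intro e e' he he'
  obtain ⟨u, hu, rfl⟩ := he
  obtain ⟨u', hu', rfl⟩ := he'
  rw [contDiffOn_pi]
  intro i
  have hc : (u i).symm ≫ₕ u' i ∈ contDiffGroupoid ∞ (𝓡 1) :=
    HasGroupoid.compatible (hu i trivial) (hu' i trivial)
  rw [contDiffGroupoid, mem_groupoid_of_pregroupoid] at hc
  have h1 := hc.1
  simp only [contDiffPregroupoid] at h1
  refine ContDiffOn.comp (g := (u' i) ∘ (u i).symm)
    (f := fun x : Fin m → EuclideanSpace ℝ (Fin 1) => x i)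
    (t := ((u i).symm ≫ₕ u' i).source) (by simpa [contDiffPregroupoid] using h1)
    (contDiff_apply ℝ _ i).contDiffOn ?_
  intro x hx
  have hx' := hx.1
  simp only [OpenPartialHomeomorph.pi, mfld_simps] at hx'
  exact ⟨hx'.1 i trivial, hx'.2 i trivial⟩

/-- The unit sphere `S^k` in `ℝ^(k+1)`. -/
abbrev UnitSphere (k : ℕ) : Type :=
  Metric.sphere (0 : EuclideanSpace ℝ (Fin (k + 1))) 1

section Immersion

variable {E : Type*} [NormedAddCommGroup E] [NormedSpace ℝ E]
  {H : Type*} [TopologicalSpace H] (I : ModelWithCorners ℝ E H)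
  {X : Type*} [TopologicalSpace X] [ChartedSpace H X]
  {V : Type*} [NormedAddCommGroup V] [InnerProductSpace ℝ V]

/-- A smooth immersion of a manifold `X` into the Euclidean space `V`: a `C^∞` map whose
differential is injective at every point. -/
structure IsSmoothImmersion (f : X → V) : Prop where
  contMDiff : ContMDiff I 𝓘(ℝ, V) ∞ f
  mfderiv_injective : ∀ x : X, Function.Injective (mfderiv I 𝓘(ℝ, V) f x)

/-- `γ` is, on the open interval `(a, b)`, a unit speed geodesic of `X` for the Riemannian metric
induced by the immersion `f : X → V`.

The Levi-Civita connection of the induced metric is the tangential part of the derivative in `V`,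
so the geodesic equation `∇_{γ'} γ' = 0` says that the acceleration of `f ∘ γ` in `V` is orthogonal
to the tangent space `df (T_{γ t} X)` at each time `t`; the induced length of `γ' t` is the norm of
`(f ∘ γ)' t`. -/
structure IsUnitSpeedGeodesic (f : X → V) (a b : ℝ) (γ : ℝ → X) : Prop where
  contMDiffOn : ContMDiffOn 𝓘(ℝ, ℝ) I 2 γ (Set.Ioo a b)
  unit_speed : ∀ t ∈ Set.Ioo a b, ‖deriv (fun s => f (γ s)) t‖ = 1
  acceleration_normal : ∀ t ∈ Set.Ioo a b, ∀ v : TangentSpace I (γ t),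
    inner ℝ (deriv (deriv fun s => f (γ s)) t) (mfderiv I 𝓘(ℝ, V) f (γ t) v : V) = 0

/-- The curvature `curv^⊥_f(X)` of an immersion `f : X → V`: the supremum of the curvatures in `V`
of the geodesics of `X` for the induced metric. The curvature in the Euclidean space `V` of a curve
of unit speed is the norm of its second derivative. -/
def normalCurvature (f : X → V) : ℝ≥0∞ :=
  ⨆ (a : ℝ) (b : ℝ) (γ : ℝ → X) (_ : IsUnitSpeedGeodesic I f a b γ) (t : ℝ)
    (_ : t ∈ Set.Ioo a b), ENNReal.ofReal ‖deriv (deriv fun s => f (γ s)) t‖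

end Immersion

end

/-! Put `m = l - 1`, `N = k + l`, `c = √(3m/(m+2))`. The immersion is a tube around a very round
torus orbit.

Orbit: let the torus `T^m` act orthogonally on `ℝ^N`, by integral characters `s j` on a copy of
`ℂ^J` and trivially on its complement. For the point `a` with coordinates `√(w j)`, the velocity and
acceleration in a direction `ξ` satisfy `‖ξa‖² = ∑ w j (s j · ξ)²` and `‖ξξa‖² = ∑ w j (s j · ξ)⁴`.
If the `s j` form a weighted design of degree four, the quartic form is `3m/(m+2)` times the square
of the quadratic one, so `‖ξξa‖ ≤ c‖ξa‖²` with `‖a‖ ≤ 1`. Such designs are built in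
`exists_integral_design`; the bound on `k` provides room for `ℂ^J`.

Tube: the normal space of the orbit at `a` has dimension `k + 1`, and the action carries it along
the orbit. Hence `(u, z) ↦ z · ((1 - r) a + r L u)`, with `L` an isometry onto the normal space,
maps `S^k × T^m` to a tube of radius `r` around the orbit scaled by `1 - r`. It lies in the unit
ball by convexity. Take `r = 1/(1+2c)`. If `c > 0`, the scaled orbit has curvature at most `κ =
c/(1-r) = 1/(2r)`; the tube has principal curvatures `1/r` along the sphere and at most `κ/(1-rκ) =
1/r` in absolute value elsewhere, so `1 + 2c` bounds them all. For `c = 0` it is the unit sphere.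

The curvature bound is proved without principal curvatures: pairing the acceleration of a geodesic
with the unit normal reduces it to the vector inequality `abs_inner_le_one_add_two_mul`. -/

open scoped ComplexConjugate

attribute [local instance] finrank_real_complex_fact'
-- The standard embedding of `S^k × (S¹)^m`
theorem contMDiff_circle_coe {n : ℕ∞ω} : ContMDiff (𝓡 1) 𝓘(ℝ, ℂ) n (fun w : Circle => (w : ℂ)) :=
  contMDiff_coe_sphere

theorem mfderiv_circle_coe_injective (z : Circle) :
    Function.Injective (mfderiv (𝓡 1) 𝓘(ℝ, ℂ) (fun w : Circle => (w : ℂ)) z) := by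
  have h := injective_mvfderiv_subtypeVal_sphere (E := ℂ) (n := 1) z
  exact h

/-- The standard inclusion of the torus `(S¹)^m` into `ℂ^m`. -/
def torusCoe (m : ℕ) (z : Torus m) : Fin m → ℂ := fun p => z p

theorem contMDiff_torusCoe (m : ℕ) :
    ContMDiff (torusModel m) 𝓘(ℝ, Fin m → ℂ) ∞ (torusCoe m) := by
  rw [contMDiff_pi_space]
  intro p
  rw [contMDiff_iff]
  refine ⟨by unfold torusCoe; fun_prop, fun x y => ?_⟩
  have h := (contMDiff_iff.1 (contMDiff_circle_coe (n := ∞))).2 (x p) y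
  refine ContDiffOn.comp (f := fun v : Fin m → EuclideanSpace ℝ (Fin 1) => v p) h
    (contDiff_apply ℝ _ p).contDiffOn ?_
  intro v hv
  refine ⟨?_, by simp [chartAt_self_eq]⟩
  have := hv.1
  simp only [extChartAt, OpenPartialHomeomorph.extend, torusModel, ModelWithCorners.pi,
    OpenPartialHomeomorph.pi, mfld_simps] at this ⊢
  exact this p trivial

theorem hasMFDerivAt_torusCoe {m : ℕ} (z : Torus m) :
    HasMFDerivAt (torusModel m) 𝓘(ℝ, Fin m → ℂ) (torusCoe m) z
      (ContinuousLinearMap.pi fun p =>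
        (mfderiv (𝓡 1) 𝓘(ℝ, ℂ) (fun w : Circle => (w : ℂ)) (z p) :
          EuclideanSpace ℝ (Fin 1) →L[ℝ] ℂ).comp (ContinuousLinearMap.proj p)) := by
  refine ⟨(contMDiff_torusCoe m).continuous.continuousAt, ?_⟩
  refine (hasFDerivWithinAt_pi' (F' := fun _ : Fin m => ℂ)).2 fun p => ?_
  have h := ((contMDiff_circle_coe (n := ∞) (z p)).mdifferentiableAt (by simp)).hasMFDerivAt.2
  refine HasFDerivWithinAt.comp (g := writtenInExtChartAt (𝓡 1) 𝓘(ℝ, ℂ) (z p) (fun w : Circle => (w : ℂ)))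
    (f := fun v : Fin m → EuclideanSpace ℝ (Fin 1) => v p) _ h
    (ContinuousLinearMap.proj (R := ℝ) (φ := fun _ : Fin m => EuclideanSpace ℝ (Fin 1))
      p).hasFDerivWithinAt ?_
  intro v _
  simp

theorem mfderiv_torusCoe_injective {m : ℕ} (z : Torus m) :
    Function.Injective (mfderiv (torusModel m) 𝓘(ℝ, Fin m → ℂ) (torusCoe m) z) := by
  rw [(hasMFDerivAt_torusCoe z).mfderiv]
  intro v w h
  funext p
  exact mfderiv_circle_coe_injective (z p) (congrFun h p)

/-- The standard inclusion of `S^k × (S¹)^m` into `ℝ^(k+1) × ℂ^m`. -/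
def sphereTorusCoe (k m : ℕ) (x : UnitSphere k × Torus m) :
    EuclideanSpace ℝ (Fin (k + 1)) × (Fin m → ℂ) :=
  ((x.1 : EuclideanSpace ℝ (Fin (k + 1))), torusCoe m x.2)

theorem contMDiff_unitSphere_coe (k : ℕ) :
    ContMDiff (𝓡 k) 𝓘(ℝ, EuclideanSpace ℝ (Fin (k + 1))) ∞
      ((↑) : UnitSphere k → EuclideanSpace ℝ (Fin (k + 1))) :=
  have := Fact.mk (@finrank_euclideanSpace_fin ℝ _ (k + 1))
  contMDiff_coe_sphere

theorem mfderiv_unitSphere_coe_injective {k : ℕ} (x : UnitSphere k) :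
    Function.Injective (mfderiv (𝓡 k) 𝓘(ℝ, EuclideanSpace ℝ (Fin (k + 1)))
      ((↑) : UnitSphere k → EuclideanSpace ℝ (Fin (k + 1))) x) := by
  have := Fact.mk (@finrank_euclideanSpace_fin ℝ _ (k + 1))
  exact injective_mvfderiv_subtypeVal_sphere x

theorem contMDiff_sphereTorusCoe (k m : ℕ) :
    ContMDiff ((𝓡 k).prod (torusModel m))
      𝓘(ℝ, EuclideanSpace ℝ (Fin (k + 1)) × (Fin m → ℂ)) ∞ (sphereTorusCoe k m) :=
  ((contMDiff_unitSphere_coe k).comp contMDiff_fst).prodMk_space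
    ((contMDiff_torusCoe m).comp contMDiff_snd)

theorem mfderiv_sphereTorusCoe_injective {k m : ℕ} (x : UnitSphere k × Torus m) :
    Function.Injective (mfderiv ((𝓡 k).prod (torusModel m))
      𝓘(ℝ, EuclideanSpace ℝ (Fin (k + 1)) × (Fin m → ℂ)) (sphereTorusCoe k m) x) := by
  have h1 := ((contMDiff_unitSphere_coe k x.1).mdifferentiableAt (by simp)).hasMFDerivAt
  have h2 := hasMFDerivAt_torusCoe x.2
  have h := (h1.comp x (hasMFDerivAt_fst x)).prodMk (h2.comp x (hasMFDerivAt_snd x))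
  have h' : HasMFDerivAt ((𝓡 k).prod (torusModel m))
      𝓘(ℝ, EuclideanSpace ℝ (Fin (k + 1)) × (Fin m → ℂ)) (sphereTorusCoe k m) x _ := ⟨h.1, h.2⟩
  rw [h'.mfderiv]
  intro v w hvw
  have hi := mfderiv_torusCoe_injective x.2
  rw [h2.mfderiv] at hi
  exact Prod.ext (mfderiv_unitSphere_coe_injective x.1 (congrArg Prod.fst hvw))
    (hi (congrArg Prod.snd hvw))

/-- The squared norm of each factor is constant on the manifold, so its derivative kills every
tangent vector. -/
theorem mfderiv_sphereTorusCoe_tangent {k m : ℕ} (x : UnitSphere k × Torus m)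
    (v : TangentSpace ((𝓡 k).prod (torusModel m)) x)
    (w : EuclideanSpace ℝ (Fin (k + 1)) × (Fin m → ℂ))
    (hw : mfderiv ((𝓡 k).prod (torusModel m))
      𝓘(ℝ, EuclideanSpace ℝ (Fin (k + 1)) × (Fin m → ℂ)) (sphereTorusCoe k m) x v = w) :
    inner ℝ (sphereTorusCoe k m x).1 w.1 = 0 ∧
      ∀ p, inner ℝ ((sphereTorusCoe k m x).2 p) (w.2 p) = 0 := by
  have key : ∀ φ : EuclideanSpace ℝ (Fin (k + 1)) × (Fin m → ℂ) → ℝ, Differentiable ℝ φ →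
      (∀ y, φ (sphereTorusCoe k m y) = 1) → fderiv ℝ φ (sphereTorusCoe k m x) w = 0 := by
    intro φ hφ h1
    have hc : φ ∘ sphereTorusCoe k m = fun _ => 1 := funext h1
    have hd := ((contMDiff_sphereTorusCoe k m x).mdifferentiableAt (by simp))
    have h := mfderiv_comp x (I'' := 𝓘(ℝ, ℝ)) hφ.differentiableAt.mdifferentiableAt hd
    rw [hc, mfderiv_const, mfderiv_eq_fderiv] at h
    have h' := congrArg (fun T => T v) h
    simp only at h'
    rw [← hw]
    exact h'.symm
  constructor
  · have h := key (fun y => inner ℝ y.1 y.1)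
      (differentiable_fst.inner ℝ differentiable_fst) (by intro y; simp [sphereTorusCoe])
    rw [((hasFDerivAt_fst (𝕜 := ℝ)).inner ℝ hasFDerivAt_fst).fderiv] at h
    simpa [fderivInnerCLM_apply, real_inner_comm] using h
  · intro p
    have h := key (fun y => inner ℝ (y.2 p) (y.2 p))
      (Differentiable.inner ℝ (by fun_prop) (by fun_prop))
      (by
        intro y
        have h1 : ‖(y.2 p : ℂ)‖ = 1 := Circle.norm_coe _
        rw [real_inner_self_eq_norm_sq]
        simp only [sphereTorusCoe, torusCoe, h1, one_pow])
    have hp : HasFDerivAt (fun y : EuclideanSpace ℝ (Fin (k + 1)) × (Fin m → ℂ) => y.2 p)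
      ((ContinuousLinearMap.proj (R := ℝ) (φ := fun _ : Fin m => ℂ) p).comp
        (ContinuousLinearMap.snd ℝ _ _)) (sphereTorusCoe k m x) :=
      hasFDerivAt_pi'.1 (hasFDerivAt_snd (E := EuclideanSpace ℝ (Fin (k + 1)))
        (F := Fin m → ℂ)) p
    rw [(hp.inner ℝ hp).fderiv] at h
    simpa [fderivInnerCLM_apply, real_inner_comm] using h

/-! ### Orthogonal torus actions -/

/-- A smooth orthogonal action of the torus on `V`, extended to a smooth family of maps indexed by
`ℂ^m`, together with its infinitesimal generators. -/
structure TorusAction (m : ℕ) (V : Type*) [NormedAddCommGroup V] [InnerProductSpace ℝ V] where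
  act : (Fin m → ℂ) → V → V
  gen : (Fin m → ℝ) →ₗ[ℝ] V →ₗ[ℝ] V
  contDiff_act : ContDiff ℝ ∞ fun q : (Fin m → ℂ) × V => act q.1 q.2
  inner_act : ∀ z : Fin m → ℂ, (∀ p, ‖z p‖ = 1) → ∀ v w, inner ℝ (act z v) (act z w) = inner ℝ v w
  hasDerivAt_act : ∀ (z : ℝ → Fin m → ℂ) (v : ℝ → V) (t : ℝ) (θ : Fin m → ℝ) (w : V),
    (∀ p, ‖z t p‖ = 1) → HasDerivAt z (fun p => θ p * Complex.I * z t p) t → HasDerivAt v w t →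
    HasDerivAt (fun s => act (z s) (v s)) (act (z t) (gen θ (v t) + w)) t
  gen_skew : ∀ θ v w, inner ℝ (gen θ v) w = - inner ℝ v (gen θ w)

/-! ### The vector inequality behind the curvature bound -/

section Estimate

variable {V : Type*} [NormedAddCommGroup V] [InnerProductSpace ℝ V]

/-- In the application `T` is the velocity `ξa` of the orbit, `y` the derivative of the unit normal,
and the combination is the velocity of the tube. The surplus of the weight `2c/(1+2c)` of `T` over
the worst case `-c/(1+2c)` from `y` is `c/(1+2c)`: the tube stays at half the focal distance. -/
theorem mul_norm_sq_le_inner_of_abs_inner_le {c : ℝ} (hc : 0 ≤ c) {T y : V}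
    (h : |inner ℝ y T| ≤ c * ‖T‖ ^ 2) :
    c / (1 + 2 * c) * ‖T‖ ^ 2 ≤
      inner ℝ ((1 - 1 / (1 + 2 * c)) • T + (1 / (1 + 2 * c)) • y) T := by
  have h1 : 0 < 1 + 2 * c := by linarith
  rw [inner_add_left, real_inner_smul_left, real_inner_smul_left, real_inner_self_eq_norm_sq]
  have h2 := (abs_le.1 h).1
  have : c / (1 + 2 * c) * ‖T‖ ^ 2 =
      (1 - 1 / (1 + 2 * c)) * ‖T‖ ^ 2 + 1 / (1 + 2 * c) * (-(c * ‖T‖ ^ 2)) := by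
    field_simp; ring
  rw [this]
  gcongr

/-- Expanding `⟪x, x⟫ = 1` gives `⟪x, y⟫ = (1 + 2c) - 2c⟪x, T⟫`, so it suffices that `0 ≤ c⟪x, T⟫ ≤
1 + 2c`. Both follow from `c/(1+2c) ‖T‖² ≤ ⟪x, T⟫ ≤ ‖T‖`. -/
theorem abs_inner_le_one_add_two_mul {c : ℝ} (hc : 0 ≤ c) {T x y : V}
    (h : |inner ℝ y T| ≤ c * ‖T‖ ^ 2)
    (hx : x = (1 - 1 / (1 + 2 * c)) • T + (1 / (1 + 2 * c)) • y) (hx1 : ‖x‖ = 1) :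
    |inner ℝ x y| ≤ 1 + 2 * c := by
  have h1 : 0 < 1 + 2 * c := by linarith
  have h2 := mul_norm_sq_le_inner_of_abs_inner_le hc h
  rw [← hx] at h2
  have h3 : inner ℝ x T ≤ ‖T‖ := by simpa [hx1] using real_inner_le_norm x T
  have hxx : inner ℝ x x = 1 := by rw [real_inner_self_eq_norm_sq, hx1, one_pow]
  have h4 : inner ℝ x y = (1 + 2 * c) - 2 * c * inner ℝ x T := by
    have : (1 : ℝ) = (1 - 1 / (1 + 2 * c)) * inner ℝ x T + 1 / (1 + 2 * c) * inner ℝ x y := by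
      rw [← real_inner_smul_right, ← real_inner_smul_right, ← inner_add_right, ← hx, hxx]
    field_simp at this
    linarith
  have h5 : 0 ≤ inner ℝ x T := le_trans (by positivity) h2
  have h6 : c * inner ℝ x T ≤ 1 + 2 * c := by
    rcases (norm_nonneg T).eq_or_lt with h0 | h0
    · have : inner ℝ x T = 0 := le_antisymm (by linarith) h5
      rw [this]; linarith
    · have h7 : c / (1 + 2 * c) * ‖T‖ ≤ 1 := by
        have : c / (1 + 2 * c) * ‖T‖ * ‖T‖ ≤ 1 * ‖T‖ := by nlinarith
        exact le_of_mul_le_mul_right this h0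
      rw [div_mul_eq_mul_div, div_le_one h1] at h7
      nlinarith
  rw [abs_le]
  constructor <;> nlinarith

theorem eq_zero_of_combination_eq_zero {c : ℝ} (hc : 0 ≤ c) {T y : V}
    (h : |inner ℝ y T| ≤ c * ‖T‖ ^ 2) (h0 : c = 0 → T = 0)
    (hx : (1 - 1 / (1 + 2 * c)) • T + (1 / (1 + 2 * c)) • y = 0) : T = 0 ∧ y = 0 := by
  have h1 : 0 < 1 + 2 * c := by linarith
  have hT : T = 0 := by
    rcases hc.eq_or_lt with h2 | h2
    · exact h0 h2.symm
    · have h3 := mul_norm_sq_le_inner_of_abs_inner_le hc h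
      rw [hx, inner_zero_left] at h3
      have : 0 < c / (1 + 2 * c) := by positivity
      have h4 : ‖T‖ ^ 2 ≤ 0 := by
        by_contra! h5
        nlinarith
      have h5 : ‖T‖ = 0 := by nlinarith [norm_nonneg T]
      exact norm_eq_zero.1 h5
  refine ⟨hT, ?_⟩
  rw [hT, smul_zero, zero_add] at hx
  exact (smul_eq_zero.1 hx).resolve_left (by positivity)

end Estimate

theorem Complex.eq_mul_I_mul_of_inner_eq_zero {z w : ℂ} (hz : ‖z‖ = 1) (h : inner ℝ z w = 0) :
    w = ((inner ℝ (Complex.I * z) w : ℝ) : ℂ) * Complex.I * z := by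
  have h1 : z.re * z.re + z.im * z.im = 1 := by
    have := Complex.normSq_eq_norm_sq z
    rw [hz, Complex.normSq_apply] at this; simpa using this
  rw [Complex.inner] at h
  simp at h
  apply Complex.ext
  · simp [Complex.inner]
    linear_combination (-w.re) * h1 + z.re * h
  · simp [Complex.inner]
    linear_combination (-w.im) * h1 + z.im * h

/-! ### Tubes around torus orbits -/

namespace TorusAction

variable {m k : ℕ} {V : Type*} [NormedAddCommGroup V] [InnerProductSpace ℝ V]
  (A : TorusAction m V) (a : V) (L : EuclideanSpace ℝ (Fin (k + 1)) →ₗᵢ[ℝ] V)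

/-- The translate by the torus element `z` of the point `(1 - r) a + r L u`. -/
noncomputable def tube (r : ℝ) (q : EuclideanSpace ℝ (Fin (k + 1)) × (Fin m → ℂ)) : V :=
  A.act q.2 ((1 - r) • a + r • L q.1)

theorem contDiff_tube (r : ℝ) : ContDiff ℝ ∞ (A.tube a L r) := by
  have h : ContDiff ℝ ∞ fun q : EuclideanSpace ℝ (Fin (k + 1)) × (Fin m → ℂ) =>
      (q.2, (1 - r) • a + r • L q.1) :=
    contDiff_snd.prodMk
      (contDiff_const.add ((L.contDiff.comp contDiff_fst).const_smul r))
  exact A.contDiff_act.comp h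

theorem norm_act {z : Fin m → ℂ} (hz : ∀ p, ‖z p‖ = 1) (v : V) : ‖A.act z v‖ = ‖v‖ := by
  rw [norm_eq_sqrt_real_inner, A.inner_act z hz, ← norm_eq_sqrt_real_inner]

theorem inner_gen_self (θ : Fin m → ℝ) (v : V) : inner ℝ (A.gen θ v) v = 0 := by
  have := A.gen_skew θ v v
  rw [real_inner_comm] at this ⊢
  linarith

/-- The angular velocity of a tangent vector `w` of the torus at `z`. -/
noncomputable def angle (z w : Fin m → ℂ) (p : Fin m) : ℝ := inner ℝ (Complex.I * z p) (w p)

/-- The velocity of the tube, translated back to the fibre over the unit. -/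
noncomputable def velocity (r : ℝ) (q w : EuclideanSpace ℝ (Fin (k + 1)) × (Fin m → ℂ)) : V :=
  (1 - r) • A.gen (angle q.2 w.2) a + r • (A.gen (angle q.2 w.2) (L q.1) + L w.1)

/-- A point of `S^k × (S¹)^m`. -/
def IsPoint (q : EuclideanSpace ℝ (Fin (k + 1)) × (Fin m → ℂ)) : Prop :=
  ‖q.1‖ = 1 ∧ ∀ p, ‖q.2 p‖ = 1

/-- A tangent vector of `S^k × (S¹)^m`. -/
def IsTangent (q w : EuclideanSpace ℝ (Fin (k + 1)) × (Fin m → ℂ)) : Prop :=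
  inner ℝ q.1 w.1 = 0 ∧ ∀ p, inner ℝ (q.2 p) (w.2 p) = 0

theorem hasDerivAt_tube (r : ℝ) {q : ℝ → EuclideanSpace ℝ (Fin (k + 1)) × (Fin m → ℂ)}
    {w : EuclideanSpace ℝ (Fin (k + 1)) × (Fin m → ℂ)} {t : ℝ} (hq : IsPoint (q t))
    (hw : IsTangent (q t) w) (h : HasDerivAt q w t) :
    HasDerivAt (fun s => A.tube a L r (q s)) (A.act (q t).2 (A.velocity a L r (q t) w)) t := by
  have hz : HasDerivAt (fun s => (q s).2) (fun p => angle (q t).2 w.2 p * Complex.I * (q t).2 p)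
      t := by
    have : w.2 = fun p => (angle (q t).2 w.2 p : ℂ) * Complex.I * (q t).2 p := by
      funext p
      exact Complex.eq_mul_I_mul_of_inner_eq_zero (hq.2 p) (hw.2 p)
    rw [← this]
    exact h.snd
  have hv : HasDerivAt (fun s => (1 - r) • a + r • L (q s).1) (r • L w.1) t := by
    have := ((L.toContinuousLinearMap.hasFDerivAt.comp_hasDerivAt t h.fst).const_smul r).const_add
      ((1 - r) • a)
    exact this
  convert A.hasDerivAt_act _ _ t _ _ hq.2 hz hv using 1
  · rfl
  · simp only [velocity, map_add, map_smul, smul_add, add_assoc]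

theorem fderiv_tube (r : ℝ) {q w : EuclideanSpace ℝ (Fin (k + 1)) × (Fin m → ℂ)} (hq : IsPoint q)
    (hw : IsTangent q w) :
    fderiv ℝ (A.tube a L r) q w = A.act q.2 (A.velocity a L r q w) := by
  have hl : HasDerivAt (fun s : ℝ => q + s • w) w 0 := by
    simpa using ((hasDerivAt_id (0 : ℝ)).smul_const w).const_add q
  have h1 := A.hasDerivAt_tube a L r (q := fun s : ℝ => q + s • w) (t := 0) (w := w)
    (by simpa using hq) (by simpa using hw) hl
  have h2 : HasFDerivAt (A.tube a L r) (fderiv ℝ (A.tube a L r) q) (q + (0 : ℝ) • w) := by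
    rw [zero_smul, add_zero]
    exact ((A.contDiff_tube a L r).differentiable (by simp) q).hasFDerivAt
  have h3 := h2.comp_hasDerivAt (0 : ℝ) hl
  have := h3.unique h1
  simpa using this

end TorusAction

/-- Vectors orthogonal to a subspace of codimension one are determined up to sign by their norm. -/
theorem Submodule.norm_eq_abs_inner_of_mem_orthogonal {V : Type*} [NormedAddCommGroup V]
    [InnerProductSpace ℝ V] [FiniteDimensional ℝ V] (S : Submodule ℝ V)
    (hS : Module.finrank ℝ V = Module.finrank ℝ S + 1) {ν v : V} (hν : ν ∈ Sᗮ) (hν1 : ‖ν‖ = 1)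
    (hv : v ∈ Sᗮ) : ‖v‖ = |inner ℝ v ν| := by
  have h1 : Module.finrank ℝ Sᗮ = 1 := by
    have := S.finrank_add_finrank_orthogonal
    omega
  have h0 : (⟨ν, hν⟩ : Sᗮ) ≠ 0 := by
    intro h
    have : ν = 0 := congrArg Subtype.val h
    simp [this] at hν1
  obtain ⟨c, hc⟩ := (finrank_eq_one_iff_of_nonzero' _ h0).1 h1 ⟨v, hv⟩
  have hc' : v = c • ν := (congrArg Subtype.val hc).symm
  rw [hc', norm_smul, real_inner_smul_left, real_inner_self_eq_norm_sq, hν1]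
  simp

/-! ### Immersion, containment and curvature of the tube -/

namespace TorusAction

variable {m k : ℕ} {V : Type*} [NormedAddCommGroup V] [InnerProductSpace ℝ V]
  (A : TorusAction m V) {a : V} {L : EuclideanSpace ℝ (Fin (k + 1)) →ₗᵢ[ℝ] V}

theorem isPoint_sphereTorusCoe (x : UnitSphere k × Torus m) : IsPoint (sphereTorusCoe k m x) :=
  ⟨by simp [sphereTorusCoe], fun _ => Circle.norm_coe _⟩

variable (a L) in
/-- The immersion of `S^k × (S¹)^m` as a tube of radius `1 / (1 + 2c)`. -/
noncomputable def tubeMap (c : ℝ) (x : UnitSphere k × Torus m) : V :=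
  A.tube a L (1 / (1 + 2 * c)) (sphereTorusCoe k m x)

variable (a L) in
theorem contMDiff_tubeMap (c : ℝ) :
    ContMDiff ((𝓡 k).prod (torusModel m)) 𝓘(ℝ, V) ∞ (A.tubeMap a L c) :=
  (A.contDiff_tube a L _).contMDiff.comp (contMDiff_sphereTorusCoe k m)

variable (a L) in
theorem exists_mfderiv_tubeMap_eq (c : ℝ) (x : UnitSphere k × Torus m)
    (v : TangentSpace ((𝓡 k).prod (torusModel m)) x) :
    ∃ w : EuclideanSpace ℝ (Fin (k + 1)) × (Fin m → ℂ), IsTangent (sphereTorusCoe k m x) w ∧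
      (w = 0 → v = 0) ∧
      (mfderiv ((𝓡 k).prod (torusModel m)) 𝓘(ℝ, V) (A.tubeMap a L c) x v : V) =
        A.act (sphereTorusCoe k m x).2
          (A.velocity a L (1 / (1 + 2 * c)) (sphereTorusCoe k m x) w) := by
  have hd := (contMDiff_sphereTorusCoe k m x).mdifferentiableAt (by simp)
  have hg : MDifferentiableAt 𝓘(ℝ, EuclideanSpace ℝ (Fin (k + 1)) × (Fin m → ℂ)) 𝓘(ℝ, V)
      (A.tube a L (1 / (1 + 2 * c))) (sphereTorusCoe k m x) :=
    ((A.contDiff_tube a L _).differentiable (by simp) _).mdifferentiableAt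
  refine ⟨mfderiv ((𝓡 k).prod (torusModel m))
      𝓘(ℝ, EuclideanSpace ℝ (Fin (k + 1)) × (Fin m → ℂ)) (sphereTorusCoe k m) x v,
    mfderiv_sphereTorusCoe_tangent x v _ rfl, fun h => ?_, ?_⟩
  · exact mfderiv_sphereTorusCoe_injective x (h.trans (map_zero _).symm)
  · rw [← fderiv_tube A a L _ (isPoint_sphereTorusCoe x)
      (mfderiv_sphereTorusCoe_tangent x v _ rfl)]
    have h := mfderiv_comp x hg hd
    rw [mfderiv_eq_fderiv] at h
    exact congrArg (fun T => T v) h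

/-- This makes the translate of `L u` a unit normal of the tube, for every radius: `ξa` is normal to
the image of `L`, `ξ(Lu) ⟂ Lu` by skewness, and `w.1 ⟂ u` on the sphere. -/
theorem inner_velocity_fiber (horth : ∀ ξ u, inner ℝ (A.gen ξ a) (L u) = 0) (r : ℝ)
    {q w : EuclideanSpace ℝ (Fin (k + 1)) × (Fin m → ℂ)} (hw : IsTangent q w) :
    inner ℝ (A.velocity a L r q w) (L q.1) = 0 := by
  have h1 : inner ℝ (L w.1) (L q.1) = 0 := by
    rw [L.inner_map_map, real_inner_comm]; exact hw.1
  rw [velocity, inner_add_left, real_inner_smul_left, real_inner_smul_left, inner_add_left, horth,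
    A.inner_gen_self, h1]
  simp

/-- Skewness moves one generator across, `⟪ξ(Lu), ξa⟫ = -⟪Lu, ξξa⟫`, so the acceleration bound on
the orbit controls its shape operator. -/
theorem abs_inner_fiber_velocity_le {c : ℝ} (horth : ∀ ξ u, inner ℝ (A.gen ξ a) (L u) = 0)
    (hgen : ∀ ξ, ‖A.gen ξ (A.gen ξ a)‖ ≤ c * ‖A.gen ξ a‖ ^ 2) (ξ : Fin m → ℝ)
    {u : EuclideanSpace ℝ (Fin (k + 1))} (hu : ‖u‖ = 1) (u' : EuclideanSpace ℝ (Fin (k + 1))) :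
    |inner ℝ (A.gen ξ (L u) + L u') (A.gen ξ a)| ≤ c * ‖A.gen ξ a‖ ^ 2 := by
  rw [inner_add_left, real_inner_comm _ (L u'), horth, add_zero, A.gen_skew, abs_neg]
  refine (abs_real_inner_le_norm _ _).trans ?_
  rw [L.norm_map, hu, one_mul]
  exact hgen ξ

theorem isSmoothImmersion_tubeMap {c : ℝ} (hc : 0 ≤ c)
    (horth : ∀ ξ u, inner ℝ (A.gen ξ a) (L u) = 0)
    (hgen : ∀ ξ, ‖A.gen ξ (A.gen ξ a)‖ ≤ c * ‖A.gen ξ a‖ ^ 2)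
    (hfree : ∀ ξ, A.gen ξ a = 0 → ξ = 0) :
    IsSmoothImmersion ((𝓡 k).prod (torusModel m)) (A.tubeMap a L c) := by
  refine ⟨A.contMDiff_tubeMap a L c, fun x => ?_⟩
  refine (injective_iff_map_eq_zero _).2 fun v hv => ?_
  obtain ⟨w, hw, hw0, hval⟩ := A.exists_mfderiv_tubeMap_eq a L c x v
  apply hw0
  have hp := isPoint_sphereTorusCoe x
  set q := sphereTorusCoe k m x
  have h0 : A.velocity a L (1 / (1 + 2 * c)) q w = 0 := by
    rw [← norm_eq_zero, ← A.norm_act hp.2, norm_eq_zero]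
    exact hval.symm.trans hv
  obtain ⟨hT, hy⟩ := eq_zero_of_combination_eq_zero hc
    (A.abs_inner_fiber_velocity_le horth hgen (angle q.2 w.2) hp.1 w.1) (fun h => by
      -- If `c = 0` then `ξξa = 0`, and skewness gives `‖ξa‖² = -⟪a, ξξa⟫ = 0`.
      have h2 := hgen (angle q.2 w.2)
      rw [h, zero_mul] at h2
      have h3 := norm_eq_zero.1 (le_antisymm h2 (norm_nonneg _))
      have h4 := A.gen_skew (angle q.2 w.2) a (A.gen (angle q.2 w.2) a)
      rw [h3, inner_zero_right, neg_zero] at h4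
      exact inner_self_eq_zero.1 h4) h0
  have hξ := hfree _ hT
  rw [hξ, map_zero, LinearMap.zero_apply, zero_add] at hy
  have h1 : w.1 = 0 := (map_eq_zero_iff L L.injective).1 hy
  refine Prod.ext h1 (funext fun p => ?_)
  rw [Complex.eq_mul_I_mul_of_inner_eq_zero (hp.2 p) (hw.2 p)]
  have : inner ℝ (Complex.I * q.2 p) (w.2 p) = 0 := congrFun hξ p
  rw [this]
  simp

theorem range_tubeMap_subset {c : ℝ} (hc : 0 ≤ c) (ha : ‖a‖ ≤ 1) :
    Set.range (A.tubeMap a L c) ⊆ Metric.closedBall 0 1 := by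
  rintro _ ⟨x, rfl⟩
  have hp := isPoint_sphereTorusCoe x
  rw [mem_closedBall_zero_iff, tubeMap, tube, A.norm_act hp.2]
  have h1 : 0 < 1 + 2 * c := by linarith
  have h2 : 1 / (1 + 2 * c) ≤ 1 := by rw [div_le_one h1]; linarith
  have h3 : 0 ≤ 1 / (1 + 2 * c) := by positivity
  refine (norm_add_le _ _).trans ?_
  rw [norm_smul, norm_smul, L.norm_map, hp.1, Real.norm_of_nonneg h3,
    Real.norm_of_nonneg (sub_nonneg.2 h2)]
  nlinarith

theorem normalCurvature_tubeMap_le [FiniteDimensional ℝ V] {c : ℝ} (hc : 0 ≤ c)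
    (hdim : Module.finrank ℝ V = k + m + 1)
    (horth : ∀ ξ u, inner ℝ (A.gen ξ a) (L u) = 0)
    (hgen : ∀ ξ, ‖A.gen ξ (A.gen ξ a)‖ ≤ c * ‖A.gen ξ a‖ ^ 2)
    (hfree : ∀ ξ, A.gen ξ a = 0 → ξ = 0) :
    normalCurvature ((𝓡 k).prod (torusModel m)) (A.tubeMap a L c) ≤
      ENNReal.ofReal (1 + 2 * c) := by
  refine iSup_le fun t₀ => iSup_le fun t₁ => iSup_le fun γ => iSup_le fun hγ => iSup_le fun t =>
    iSup_le fun ht => ENNReal.ofReal_le_ofReal ?_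
  set r := 1 / (1 + 2 * c) with hr
  set q : ℝ → EuclideanSpace ℝ (Fin (k + 1)) × (Fin m → ℂ) := fun s => sphereTorusCoe k m (γ s)
    with hq
  have hp : ∀ s, IsPoint (q s) := fun s => isPoint_sphereTorusCoe (γ s)
  have h2top : (2 : ℕ∞ω) ≤ ((⊤ : ℕ∞) : ℕ∞ω) := by
    change ((2 : ℕ∞) : ℕ∞ω) ≤ _
    exact_mod_cast le_top
  have hopen : ∀ s ∈ Set.Ioo t₀ t₁, Set.Ioo t₀ t₁ ∈ nhds s := fun s hs => isOpen_Ioo.mem_nhds hs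
  have hq2 : ∀ s ∈ Set.Ioo t₀ t₁, ContDiffAt ℝ 2 q s := by
    intro s hs
    have h1 := (hγ.contMDiffOn s hs).contMDiffAt (hopen s hs)
    have h2 := ((contMDiff_sphereTorusCoe k m).of_le h2top (γ s)).comp s h1
    exact h2.contDiffAt
  have hqd : ∀ s ∈ Set.Ioo t₀ t₁, HasDerivAt q (deriv q s) s := fun s hs =>
    ((hq2 s hs).differentiableAt (by norm_num)).hasDerivAt
  have htan : ∀ s ∈ Set.Ioo t₀ t₁, IsTangent (q s) (deriv q s) := by
    intro s hs
    have h1 : HasDerivAt (fun s => (q s).1) (deriv q s).1 s := (hqd s hs).fst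
    have h2 : HasDerivAt (fun s => (q s).2) (deriv q s).2 s := (hqd s hs).snd
    constructor
    · have h3 := h1.inner ℝ h1
      have h4 : (fun s => inner ℝ (q s).1 (q s).1) = fun _ => (1 : ℝ) := by
        funext s; rw [real_inner_self_eq_norm_sq, (hp s).1, one_pow]
      rw [h4] at h3
      have := h3.unique (hasDerivAt_const s (1 : ℝ))
      rw [real_inner_comm (q s).1] at this
      linarith
    · intro p
      have h2 := (hasDerivAt_pi.1 h2) p
      have h3 := h2.inner ℝ h2
      have h4 : (fun s => inner ℝ ((q s).2 p) ((q s).2 p)) = fun _ => (1 : ℝ) := by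
        funext s; rw [real_inner_self_eq_norm_sq, (hp s).2, one_pow]
      rw [h4] at h3
      have := h3.unique (hasDerivAt_const s (1 : ℝ))
      rw [real_inner_comm ((q s).2 p)] at this
      linarith
  have hc1 : ∀ s ∈ Set.Ioo t₀ t₁, HasDerivAt (fun s => A.tubeMap a L c (γ s))
      (A.act (q s).2 (A.velocity a L r (q s) (deriv q s))) s := fun s hs =>
    A.hasDerivAt_tube a L r (hp s) (htan s hs) (hqd s hs)
  have hν1 : ∀ s ∈ Set.Ioo t₀ t₁, HasDerivAt (fun s => A.tube a L 1 (q s))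
      (A.act (q s).2 (A.velocity a L 1 (q s) (deriv q s))) s := fun s hs =>
    A.hasDerivAt_tube a L 1 (hp s) (htan s hs) (hqd s hs)
  -- The unit normal is itself the tube with `r = 1`, so one derivative formula serves both.
  have hν : ∀ s, A.tube a L 1 (q s) = A.act (q s).2 (L (q s).1) := by
    intro s; simp [tube]
  have hc2 : HasDerivAt (deriv fun s => A.tubeMap a L c (γ s))
      (deriv (deriv fun s => A.tubeMap a L c (γ s)) t) t := by
    have h1 : ContDiffAt ℝ 2 (fun s => A.tubeMap a L c (γ s)) t :=
      ((A.contDiff_tube a L r).of_le h2top).contDiffAt.comp t (hq2 t ht)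
    have h2 : ContDiffAt ℝ 1 (deriv fun s => A.tubeMap a L c (γ s)) t :=
      (h1.fderiv_right (by norm_num)).clm_apply contDiffAt_const
    exact (h2.differentiableAt (by norm_num)).hasDerivAt
  -- Differentiating velocity `⟂` normal gives `⟪acceleration, ν⟫ = -⟪velocity, ν'⟫`.
  have hzero : HasDerivAt (fun s => inner ℝ (deriv (fun s => A.tubeMap a L c (γ s)) s)
      (A.tube a L 1 (q s))) 0 t := by
    refine (hasDerivAt_const t (0 : ℝ)).congr_of_eventuallyEq ?_
    filter_upwards [hopen t ht] with s hs
    rw [(hc1 s hs).deriv, hν, A.inner_act _ (hp s).2, A.inner_velocity_fiber horth r (htan s hs)]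
  have hprod := (hc2.inner ℝ (hν1 t ht)).unique hzero
  have hunit := hγ.unit_speed t ht
  rw [(hc1 t ht).deriv] at hprod hunit
  rw [A.norm_act (hp t).2] at hunit
  rw [A.inner_act _ (hp t).2] at hprod
  obtain ⟨D, hD⟩ : ∃ D : EuclideanSpace ℝ (Fin k) × (Fin m → EuclideanSpace ℝ (Fin 1)) →ₗ[ℝ] V,
      ∀ v, D v = mfderiv ((𝓡 k).prod (torusModel m)) 𝓘(ℝ, V) (A.tubeMap a L c) (γ t) v :=
    ⟨(mfderiv ((𝓡 k).prod (torusModel m)) 𝓘(ℝ, V) (A.tubeMap a L c) (γ t)).toLinearMap,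
      fun _ => rfl⟩
  have hDinj : Function.Injective D := fun v w h =>
    (A.isSmoothImmersion_tubeMap hc horth hgen hfree).mfderiv_injective (γ t)
      ((hD v).symm.trans (h.trans (hD w)))
  -- Codimension one: the acceleration of a geodesic is a multiple of `ν`, so its norm is
  -- `|⟪acceleration, ν⟫|`.
  have hSdim : Module.finrank ℝ V = Module.finrank ℝ (LinearMap.range D) + 1 := by
    rw [hdim, LinearMap.finrank_range_of_inj hDinj]
    simp [Module.finrank_pi_fintype]
  have hνS : A.tube a L 1 (q t) ∈ (LinearMap.range D)ᗮ := by
    rintro _ ⟨v, rfl⟩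
    obtain ⟨w, hw, -, hval⟩ := A.exists_mfderiv_tubeMap_eq a L c (γ t) v
    rw [(hD v).trans hval, hν, A.inner_act _ (hp t).2]
    exact A.inner_velocity_fiber horth _ hw
  have haS : deriv (deriv fun s => A.tubeMap a L c (γ s)) t ∈ (LinearMap.range D)ᗮ := by
    rintro _ ⟨v, rfl⟩
    rw [real_inner_comm, hD]
    exact hγ.acceleration_normal t ht v
  have hνn : ‖A.tube a L 1 (q t)‖ = 1 := by
    rw [hν, A.norm_act (hp t).2, L.norm_map, (hp t).1]
  rw [(LinearMap.range D).norm_eq_abs_inner_of_mem_orthogonal hSdim hνS hνn haS]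
  have hle := abs_inner_le_one_add_two_mul hc
    (A.abs_inner_fiber_velocity_le horth hgen (angle (q t).2 (deriv q t).2) (hp t).1 (deriv q t).1)
    rfl hunit
  have hv1 : A.velocity a L 1 (q t) (deriv q t) =
      A.gen (angle (q t).2 (deriv q t).2) (L (q t).1) + L (deriv q t).1 := by
    simp [velocity]
  rw [hv1] at hprod
  refine le_trans (le_of_eq ?_) hle
  rw [← abs_neg]
  congr 1
  change _ = inner ℝ (A.velocity a L r (q t) (deriv q t)) _
  linarith

end TorusAction

/-! ### Moments of signed vectors -/

/-- The sum over all signs of the squares of the signed sums. -/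
theorem sum_signs_sq {m : ℕ} (w : Fin m → ℝ) :
    ∑ ε : Fin m → Bool, (∑ p, (if ε p then 1 else -1) * w p) ^ 2 = 2 ^ m * ∑ p, w p ^ 2 := by
  induction m with
  | zero => simp
  | succ m ih =>
    rw [← (Fin.consEquiv fun _ => Bool).sum_comp, Fintype.sum_prod_type]
    simp only [Fin.consEquiv_apply, Fin.sum_univ_succ, Fin.cons_zero, Fin.cons_succ,
      Fintype.sum_bool, if_true, Bool.false_eq_true, if_false]
    rw [← Finset.sum_add_distrib]
    have : ∀ ε : Fin m → Bool,
        (1 * w 0 + ∑ p : Fin m, (if ε p then 1 else -1) * w p.succ) ^ 2 +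
        (-1 * w 0 + ∑ p : Fin m, (if ε p then 1 else -1) * w p.succ) ^ 2 =
        2 * w 0 ^ 2 + 2 * (∑ p : Fin m, (if ε p then 1 else -1) * w p.succ) ^ 2 := by
      intro ε; ring
    simp only [this, Finset.sum_add_distrib, ← Finset.mul_sum, ih fun p => w p.succ]
    simp
    ring

/-- The sum over all signs of the fourth powers of the signed sums. -/
theorem sum_signs_pow_four {m : ℕ} (w : Fin m → ℝ) :
    ∑ ε : Fin m → Bool, (∑ p, (if ε p then 1 else -1) * w p) ^ 4 =
      2 ^ m * (3 * (∑ p, w p ^ 2) ^ 2 - 2 * ∑ p, w p ^ 4) := by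
  induction m with
  | zero => simp
  | succ m ih =>
    rw [← (Fin.consEquiv fun _ => Bool).sum_comp, Fintype.sum_prod_type]
    simp only [Fin.consEquiv_apply, Fin.sum_univ_succ, Fin.cons_zero, Fin.cons_succ,
      Fintype.sum_bool, if_true, Bool.false_eq_true, if_false]
    rw [← Finset.sum_add_distrib]
    have : ∀ ε : Fin m → Bool,
        (1 * w 0 + ∑ p : Fin m, (if ε p then 1 else -1) * w p.succ) ^ 4 +
        (-1 * w 0 + ∑ p : Fin m, (if ε p then 1 else -1) * w p.succ) ^ 4 =
        2 * w 0 ^ 4 + 12 * w 0 ^ 2 * (∑ p : Fin m, (if ε p then 1 else -1) * w p.succ) ^ 2 +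
          2 * (∑ p : Fin m, (if ε p then 1 else -1) * w p.succ) ^ 4 := by
      intro ε; ring
    simp only [this, Finset.sum_add_distrib, ← Finset.mul_sum, ih fun p => w p.succ,
      sum_signs_sq fun p => w p.succ]
    simp
    ring

section Orbit

variable {m : ℕ} (d e : ℝ) (v : Fin m → ℝ)

theorem sum_update_sq_mul (i : Fin m) (x : Fin m → ℝ) :
    ∑ p, (if p = i then d else e) ^ 2 * x p = e ^ 2 * ∑ p, x p + (d ^ 2 - e ^ 2) * x i := by
  have : ∀ p, (if p = i then d else e) ^ 2 * x p =
      e ^ 2 * x p + if p = i then (d ^ 2 - e ^ 2) * x p else 0 := by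
    intro p; split_ifs <;> ring
  simp only [this, Finset.sum_add_distrib, ← Finset.mul_sum, Finset.sum_ite_eq', Finset.mem_univ,
    if_true]

theorem sum_orbit_sq :
    ∑ j : (Fin m → Bool) × Fin m,
      (∑ p, ((if j.1 p then 1 else -1) * if p = j.2 then d else e) * v p) ^ 2 =
      2 ^ m * ((m * e ^ 2 + (d ^ 2 - e ^ 2)) * ∑ p, v p ^ 2) := by
  rw [Fintype.sum_prod_type_right]
  have h : ∀ i : Fin m, ∑ ε : Fin m → Bool,
      (∑ p, ((if ε p then 1 else -1) * if p = i then d else e) * v p) ^ 2 =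
      2 ^ m * ∑ p, (if p = i then d else e) ^ 2 * v p ^ 2 := by
    intro i
    simp only [mul_assoc, ← mul_pow]
    exact sum_signs_sq fun p => (if p = i then d else e) * v p
  simp only [h, sum_update_sq_mul d e _ (fun p => v p ^ 2), Finset.sum_add_distrib,
    Finset.sum_const, Finset.card_univ, Fintype.card_fin, nsmul_eq_mul, ← Finset.mul_sum]
  ring

/-- Averaging over signs removes monomials with odd exponents, and moving the entry `d` symmetrises
the rest, so only `(∑ v²)²` and `∑ v⁴` survive. The coefficient of `∑ v⁴` is the obstruction to
being a design. -/
theorem sum_orbit_pow_four :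
    ∑ j : (Fin m → Bool) × Fin m,
      (∑ p, ((if j.1 p then 1 else -1) * if p = j.2 then d else e) * v p) ^ 4 =
      2 ^ m * (3 * (m * e ^ 4 + 2 * e ^ 2 * (d ^ 2 - e ^ 2)) * (∑ p, v p ^ 2) ^ 2 +
        (3 * (d ^ 2 - e ^ 2) ^ 2 - 2 * ((m - 1) * e ^ 4 + d ^ 4)) * ∑ p, v p ^ 4) := by
  have h4 : ∀ i : Fin m, ∑ p, (if p = i then d else e) ^ 4 * v p ^ 4 =
      e ^ 4 * ∑ p, v p ^ 4 + (d ^ 4 - e ^ 4) * v i ^ 4 := by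
    intro i
    have := sum_update_sq_mul (d ^ 2) (e ^ 2) i fun p => v p ^ 4
    simp only [← pow_mul] at this
    rw [← this]
    refine Finset.sum_congr rfl fun p _ => ?_
    split_ifs <;> ring
  rw [Fintype.sum_prod_type_right]
  have h : ∀ i : Fin m, ∑ ε : Fin m → Bool,
      (∑ p, ((if ε p then 1 else -1) * if p = i then d else e) * v p) ^ 4 =
      2 ^ m * (3 * (∑ p, (if p = i then d else e) ^ 2 * v p ^ 2) ^ 2 -
        2 * ∑ p, (if p = i then d else e) ^ 4 * v p ^ 4) := by
    intro i
    simp only [mul_assoc, ← mul_pow]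
    exact sum_signs_pow_four fun p => (if p = i then d else e) * v p
  simp only [h, sum_update_sq_mul d e _ (fun p => v p ^ 2), h4]
  have h5 : ∀ i : Fin m, (e ^ 2 * ∑ p, v p ^ 2 + (d ^ 2 - e ^ 2) * v i ^ 2) ^ 2 =
      e ^ 4 * (∑ p, v p ^ 2) ^ 2 + 2 * e ^ 2 * (d ^ 2 - e ^ 2) * (∑ p, v p ^ 2) * v i ^ 2 +
        (d ^ 2 - e ^ 2) ^ 2 * v i ^ 4 := by intro i; ring
  simp only [h5, Finset.sum_add_distrib, Finset.sum_sub_distrib, ← Finset.mul_sum,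
    Finset.sum_const, Finset.card_univ, Fintype.card_fin, nsmul_eq_mul]
  ring

end Orbit

/-! ### Weighted integral designs -/

/-- The weight which makes the quartic form of a mixed design proportional to `(∑ v_p ^ 2) ^ 2`. -/
theorem exists_mixing_weight {m D A : ℝ} (hm : 2 ≤ m) (hD : 0 < D) (hA : 0 < A)
    (h : D ^ 2 - 6 * A * D + (5 - 2 * m) * A ^ 2 ≤ 0) :
    ∃ μ : ℝ, 0 ≤ μ ∧ μ ≤ 1 ∧
      μ * (3 * (m * A ^ 2 + 2 * A * (D - A))) = 3 * (D + (m - 1) * A) ^ 2 / (m + 2) ∧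
      μ * (3 * (D - A) ^ 2 - 2 * ((m - 1) * A ^ 2 + D ^ 2)) +
        (1 - μ) * (D + (m - 1) * A) ^ 2 = 0 := by
  have h1 : 0 < (m - 2) * A + 2 * D := by nlinarith
  have h2 : 0 < (m + 2) * A * ((m - 2) * A + 2 * D) := by positivity
  have hne : (m - 2) * A + 2 * D ≠ 0 := h1.ne'
  have hm2 : m + 2 ≠ 0 := by linarith
  -- This `μ` cancels the coefficient of `∑ v⁴`: with `D = d²`, `A = e²`, that coefficient is `β =
  -- D² - 6AD + (5-2m)A²` for the orbit of `(d, e, …, e)` and `S² = (D + (m-1)A)²` for the axis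
  -- vectors. So `μ = S²/(S² - β)`, and `β ≤ 0` is exactly `μ ≤ 1`.
  refine ⟨(D + (m - 1) * A) ^ 2 / ((m + 2) * A * ((m - 2) * A + 2 * D)), by positivity, ?_, ?_, ?_⟩
  · rw [div_le_one h2]
    nlinarith
  · generalize hQ : (m - 2) * A + 2 * D = Q at *
    field_simp
    rw [← hQ]
    ring
  · generalize hQ : (m - 2) * A + 2 * D = Q at *
    field_simp
    rw [← hQ]
    ring

/-- A vector `(d, e, …, e)` of integral norm with small sum of fourth powers. -/
theorem exists_flat_integer_vector (n : ℕ) (hn : 1 ≤ n) :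
    ∃ d e R : ℤ, 0 < d ∧ 0 < e ∧ 0 < R ∧ R ^ 2 = d ^ 2 + n * e ^ 2 ∧
      ((d : ℝ) ^ 2) ^ 2 - 6 * e ^ 2 * d ^ 2 + (5 - 2 * ((n : ℝ) + 1)) * ((e : ℝ) ^ 2) ^ 2 ≤ 0 := by
  obtain ⟨a, ha1, ha2⟩ : ∃ a : ℕ, a * a ≤ n ∧ n < (a + 1) * (a + 1) :=
    ⟨Nat.sqrt n, Nat.sqrt_le n, Nat.lt_succ_sqrt n⟩
  have h1 : ((a : ℤ)) * a ≤ n := by exact_mod_cast ha1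
  have h2 : (n : ℤ) < (a + 1) * (a + 1) := by exact_mod_cast ha2
  -- With `x = (a + 1)²`, this is `(x - n)² + 4nx = (x + n)²`. Taking `a = ⌊√n⌋` makes `d` positive
  -- and at most `e`.
  refine ⟨(a + 1) ^ 2 - n, 2 * (a + 1), n + (a + 1) ^ 2, by nlinarith, by positivity,
    by positivity, by ring, ?_⟩
  have h3 : (0 : ℝ) < ((a : ℝ) + 1) ^ 2 - n := by
    have : (n : ℝ) < (a + 1) * (a + 1) := by exact_mod_cast h2
    nlinarith
  have h4 : ((a : ℝ) + 1) ^ 2 - n ≤ 2 * (a + 1) := by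
    have : (a : ℝ) * a ≤ n := by exact_mod_cast h1
    nlinarith
  push_cast
  -- For `n = 1` the last coefficient is positive, but the triple is `(3, 4, 5)` and can be checked
  -- directly; for `n ≥ 2` the coefficient is negative and `d ≤ e` suffices.
  rcases hn.eq_or_lt with h | h
  · have : a = 1 := by subst h; nlinarith
    subst this; subst h; norm_num
  · have hn2 : (2 : ℝ) ≤ n := by exact_mod_cast h
    set d : ℝ := ((a : ℝ) + 1) ^ 2 - n
    set e : ℝ := 2 * ((a : ℝ) + 1)
    have h5 : d ^ 2 ≤ e ^ 2 := by gcongr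
    have h6 : d ^ 2 * d ^ 2 ≤ e ^ 2 * d ^ 2 := by gcongr
    have h7 : (5 - 2 * ((n : ℝ) + 1)) * (e ^ 2) ^ 2 ≤ 0 :=
      mul_nonpos_of_nonpos_of_nonneg (by linarith) (by positivity)
    nlinarith [sq_nonneg (e * d)]

/-- The left side is the real dimension of `ℂ^J`; the hypothesis on `k` serves only to make this
space fit. The estimate is crude. -/
theorem two_mul_card_design_le {m : ℕ} :
    2 * Fintype.card (((Fin m → Bool) × Fin m) ⊕ Fin m) ≤ (m + 1) ^ (m + 1) ^ 4 := by
  rcases Nat.eq_zero_or_pos m with rfl | hm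
  · simp
  simp only [Fintype.card_sum, Fintype.card_prod, Fintype.card_fun, Fintype.card_bool,
    Fintype.card_fin]
  have h1 : m ≤ 2 ^ m := Nat.lt_two_pow_self.le
  have h2 : 1 ≤ 2 ^ m := Nat.one_le_two_pow
  calc 2 * (2 ^ m * m + m) ≤ 2 * (2 ^ m * 2 ^ m + 2 ^ m * 2 ^ m) := by
        gcongr
        exact h1.trans (Nat.le_mul_of_pos_left _ h2)
    _ = 2 ^ (2 * m + 2) := by ring
    _ ≤ 2 ^ (m + 1) ^ 4 := by
        apply Nat.pow_le_pow_right (by norm_num)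
        have : 2 * m + 2 ≤ (m + 1) ^ 2 := by nlinarith
        exact this.trans (Nat.pow_le_pow_right (by omega) (by norm_num))
    _ ≤ (m + 1) ^ (m + 1) ^ 4 := Nat.pow_le_pow_left (by omega) _

/-- Weighted integral designs: the quartic form is bounded by the optimal multiple of the square of
the quadratic form. -/
theorem exists_integral_design (m : ℕ) :
    ∃ (s : ((Fin m → Bool) × Fin m) ⊕ Fin m → Fin m → ℤ)
      (w : ((Fin m → Bool) × Fin m) ⊕ Fin m → ℝ), (∀ j, 0 ≤ w j) ∧ ∑ j, w j ≤ 1 ∧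
      (∀ v : Fin m → ℝ, ∑ j, w j * (∑ p, s j p * v p) ^ 4 ≤
        3 * m / (m + 2) * (∑ j, w j * (∑ p, s j p * v p) ^ 2) ^ 2) ∧
      ∀ v : Fin m → ℝ, ∑ j, w j * (∑ p, s j p * v p) ^ 2 = 0 → v = 0 := by
  rcases Nat.eq_zero_or_pos m with rfl | hm
  · exact ⟨0, 0, by simp, by simp, by simp, fun v _ => Subsingleton.elim _ _⟩
  obtain ⟨d, e, R, μ, hR, hRsq, hμ0, hμ1, hμ⟩ : ∃ (d e R : ℤ) (μ : ℝ), 0 < R ∧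
      R ^ 2 = d ^ 2 + (m - 1) * e ^ 2 ∧ 0 ≤ μ ∧ μ ≤ 1 ∧ ∀ v : Fin m → ℝ,
      μ * (3 * (m * (e : ℝ) ^ 4 + 2 * e ^ 2 * (d ^ 2 - e ^ 2)) * (∑ p, v p ^ 2) ^ 2 +
        (3 * ((d : ℝ) ^ 2 - e ^ 2) ^ 2 - 2 * ((m - 1) * e ^ 4 + d ^ 4)) * ∑ p, v p ^ 4) +
        (1 - μ) * R ^ 4 * ∑ p, v p ^ 4 = 3 * R ^ 4 / (m + 2) * (∑ p, v p ^ 2) ^ 2 := by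
    rcases (show 1 ≤ m from hm).eq_or_lt with h | h
    · have : m = 1 := h.symm
      subst this
      -- On a line the axis vector alone is a design.
      refine ⟨1, 0, 1, 0, by norm_num, by norm_num, le_rfl, zero_le_one, fun v => ?_⟩
      simp
      ring
    · obtain ⟨n, rfl⟩ : ∃ n, m = n + 1 := ⟨m - 1, by omega⟩
      obtain ⟨d, e, R, hd, he, hR, hRsq, hde⟩ := exists_flat_integer_vector n (by omega)
      have hd' : (0 : ℝ) < d := by exact_mod_cast hd
      have he' : (0 : ℝ) < e := by exact_mod_cast he
      obtain ⟨μ, h0, h1, h2, h3⟩ := exists_mixing_weight (m := (n : ℝ) + 1) (D := (d : ℝ) ^ 2)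
        (A := (e : ℝ) ^ 2) (by exact_mod_cast h) (by positivity) (by positivity) hde
      have hR4 : ((d : ℝ) ^ 2 + ((n : ℝ) + 1 - 1) * (e : ℝ) ^ 2) ^ 2 = (R : ℝ) ^ 4 := by
        have : (R : ℝ) ^ 2 = d ^ 2 + n * e ^ 2 := by exact_mod_cast hRsq
        rw [add_sub_cancel_right, ← this]; ring
      rw [hR4] at h2 h3
      refine ⟨d, e, R, μ, hR, by push_cast; rw [hRsq]; ring, h0, h1, fun v => ?_⟩
      push_cast
      linear_combination (∑ p, v p ^ 2) ^ 2 * h2 + (∑ p, v p ^ 4) * h3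
  have hm0 : (m : ℝ) ≠ 0 := by exact_mod_cast hm.ne'
  have hR0 : (0 : ℝ) < R := by exact_mod_cast hR
  have hRsq' : (R : ℝ) ^ 2 = d ^ 2 + (m - 1) * e ^ 2 := by exact_mod_cast hRsq
  -- Both families consist of vectors of norm `R`, so the quadratic form does not depend on `μ`. The
  -- axis vectors `R eᵢ` are integral because `R` is.
  set s : ((Fin m → Bool) × Fin m) ⊕ Fin m → Fin m → ℤ :=
    Sum.elim (fun j p => (if j.1 p then 1 else -1) * if p = j.2 then d else e)
      (fun i p => if p = i then R else 0) with hs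
  set w : ((Fin m → Bool) × Fin m) ⊕ Fin m → ℝ :=
    Sum.elim (fun _ => μ / (2 ^ m * m)) (fun _ => (1 - μ) / m) with hw
  have hQ2 : ∀ v : Fin m → ℝ, ∑ j, w j * (∑ p, s j p * v p) ^ 2 = R ^ 2 / m * ∑ p, v p ^ 2 := by
    intro v
    have h := sum_orbit_sq (d : ℝ) e v
    simp only [hs, hw, Fintype.sum_sum_type, Sum.elim_inl, Sum.elim_inr, ← Finset.mul_sum]
    push_cast
    rw [h]
    simp only [ite_mul, zero_mul, Finset.sum_ite_eq', Finset.mem_univ, if_true, mul_pow,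
      ← Finset.mul_sum]
    field_simp
    linear_combination -μ * (∑ p, v p ^ 2) * hRsq'
  have hQ4 : ∀ v : Fin m → ℝ, ∑ j, w j * (∑ p, s j p * v p) ^ 4 =
      3 * R ^ 4 / (m * (m + 2)) * (∑ p, v p ^ 2) ^ 2 := by
    intro v
    have h := sum_orbit_pow_four (d : ℝ) e v
    simp only [hs, hw, Fintype.sum_sum_type, Sum.elim_inl, Sum.elim_inr, ← Finset.mul_sum]
    push_cast
    rw [h]
    simp only [ite_mul, zero_mul, Finset.sum_ite_eq', Finset.mem_univ, if_true, mul_pow,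
      ← Finset.mul_sum]
    have h2 : 3 * (R : ℝ) ^ 4 / (m * (m + 2)) * (∑ p, v p ^ 2) ^ 2 =
        (3 * R ^ 4 / (m + 2) * (∑ p, v p ^ 2) ^ 2) / m := by field_simp
    rw [h2, ← hμ v]
    field_simp
  refine ⟨s, w, ?_, ?_, fun v => ?_, fun v hv => ?_⟩
  · rintro (j | j)
    · simp only [hw, Sum.elim_inl]; positivity
    · simp only [hw, Sum.elim_inr]
      exact div_nonneg (by linarith) (by positivity)
  · simp only [hw, Fintype.sum_sum_type, Sum.elim_inl, Sum.elim_inr, Finset.sum_const,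
      Finset.card_univ, Fintype.card_prod, Fintype.card_fun, Fintype.card_bool, Fintype.card_fin,
      nsmul_eq_mul]
    push_cast
    field_simp
    linarith
  · rw [hQ4, hQ2]
    apply le_of_eq
    field_simp
  · rw [hQ2] at hv
    have h1 := (mul_eq_zero.1 hv).resolve_left (by positivity)
    rw [Finset.sum_eq_zero_iff_of_nonneg fun p _ => sq_nonneg _] at h1
    funext p
    exact pow_eq_zero_iff (two_ne_zero) |>.1 (h1 p (Finset.mem_univ p))

/-! ### Diagonal torus actions -/

/-- The smooth extension of `z ↦ z ^ n`, `n` an integer, from the circle to the plane. -/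
noncomputable def circlePow (n : ℤ) (z : ℂ) : ℂ := z ^ n.toNat * conj z ^ (-n).toNat

/-- Negative powers use `conj z`, which equals `z⁻¹` on the circle and, unlike it, is smooth at `0`.
-/
theorem contDiff_circlePow (n : ℤ) : ContDiff ℝ ∞ (circlePow n) :=
  (contDiff_id.pow _).mul (Complex.conjCLE.contDiff.pow _)

theorem norm_circlePow (n : ℤ) {z : ℂ} (hz : ‖z‖ = 1) : ‖circlePow n z‖ = 1 := by
  simp [circlePow, hz]

theorem hasDerivAt_circlePow (n : ℤ) {z : ℝ → ℂ} {t θ : ℝ}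
    (hz : HasDerivAt z (θ * Complex.I * z t) t) :
    HasDerivAt (fun s => circlePow n (z s)) (n * θ * Complex.I * circlePow n (z t)) t := by
  have hpow : ∀ (a : ℕ) (y : ℝ → ℂ) (c : ℂ), HasDerivAt y (c * y t) t →
      HasDerivAt (fun s => y s ^ a) (a * c * y t ^ a) t := by
    intro a y c hy
    refine (hy.fun_pow a).congr_deriv ?_
    rcases a with _ | a
    · simp
    · simp only [Nat.add_sub_cancel]; ring
  have h1 := hpow n.toNat z _ hz
  have h2 := hpow (-n).toNat (fun s => conj (z s)) (-(θ * Complex.I)) (by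
    have := Complex.conjCLE.hasFDerivAt.comp_hasDerivAt t hz
    refine HasDerivAt.congr_deriv this ?_
    simp)
  refine (h1.mul h2).congr_deriv ?_
  have h3 : (n : ℂ) = n.toNat - (-n).toNat := by
    exact_mod_cast (Int.toNat_sub_toNat_neg n).symm
  rw [h3, circlePow]
  ring

/-- The smooth extension of a character of the torus. -/
noncomputable def torusCharacter {m : ℕ} (s : Fin m → ℤ) (z : Fin m → ℂ) : ℂ :=
  ∏ p, circlePow (s p) (z p)

theorem contDiff_torusCharacter {m : ℕ} (s : Fin m → ℤ) : ContDiff ℝ ∞ (torusCharacter s) :=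
  contDiff_prod fun p _ => (contDiff_circlePow (s p)).comp (contDiff_apply ℝ ℂ p)

theorem norm_torusCharacter {m : ℕ} (s : Fin m → ℤ) {z : Fin m → ℂ} (hz : ∀ p, ‖z p‖ = 1) :
    ‖torusCharacter s z‖ = 1 := by
  rw [torusCharacter, norm_prod]
  exact Finset.prod_eq_one fun p _ => norm_circlePow _ (hz p)

theorem hasDerivAt_torusCharacter {m : ℕ} (s : Fin m → ℤ) {z : ℝ → Fin m → ℂ} {t : ℝ}
    {θ : Fin m → ℝ} (hz : HasDerivAt z (fun p => θ p * Complex.I * z t p) t) :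
    HasDerivAt (fun r => torusCharacter s (z r))
      (((∑ p, s p * θ p : ℝ) : ℂ) * Complex.I * torusCharacter s (z t)) t := by
  have h := HasDerivAt.fun_finsetProd (u := Finset.univ) (f := fun p r => circlePow (s p) (z r p))
    fun p _ => hasDerivAt_circlePow (s p) (hasDerivAt_pi.1 hz p)
  refine h.congr_deriv ?_
  push_cast
  rw [eq_comm, Finset.sum_mul, Finset.sum_mul]
  refine Finset.sum_congr rfl fun p hp => ?_
  rw [torusCharacter, ← Finset.mul_prod_erase _ _ hp, smul_eq_mul]
  ring

section Diagonal

variable {m : ℕ} {J : Type*} [Fintype J] (s : J → Fin m → ℤ)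

/-- The diagonal action of the torus with the characters `s`. -/
noncomputable def diagonalAct (z : Fin m → ℂ) (x : PiLp 2 fun _ : J => ℂ) :
    PiLp 2 fun _ : J => ℂ :=
  WithLp.toLp 2 fun j => torusCharacter (s j) (z) * x j

theorem contDiff_diagonalAct :
    ContDiff ℝ ∞ fun q : (Fin m → ℂ) × PiLp 2 (fun _ : J => ℂ) => diagonalAct s q.1 q.2 := by
  rw [contDiff_piLp]
  intro j
  have h : ContDiff ℝ ∞ fun q : (Fin m → ℂ) × PiLp 2 (fun _ : J => ℂ) => q.2 j :=
    (contDiff_piLp 2).1 contDiff_snd j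
  exact ((contDiff_torusCharacter (s j)).comp contDiff_fst).mul h

theorem inner_diagonalAct {z : Fin m → ℂ} (hz : ∀ p, ‖z p‖ = 1) (x y : PiLp 2 fun _ : J => ℂ) :
    inner ℝ (diagonalAct s z x) (diagonalAct s z y) = inner ℝ x y := by
  rw [PiLp.inner_apply, PiLp.inner_apply]
  refine Finset.sum_congr rfl fun j _ => ?_
  have h : torusCharacter (s j) z * conj (torusCharacter (s j) z) = 1 := by
    rw [Complex.mul_conj, Complex.normSq_eq_norm_sq, norm_torusCharacter _ hz]; simp
  simp only [diagonalAct, Complex.inner, map_mul]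
  congr 1
  linear_combination (conj (x j) * y j) * h

/-- The infinitesimal generator of the diagonal action. -/
noncomputable def diagonalGen : (Fin m → ℝ) →ₗ[ℝ] (PiLp 2 fun _ : J => ℂ) →ₗ[ℝ]
    PiLp 2 fun _ : J => ℂ :=
  LinearMap.mk₂ ℝ (fun θ x => WithLp.toLp 2 fun j =>
      ((∑ p, s j p * θ p : ℝ) : ℂ) * Complex.I * x j)
    (fun θ θ' x => by
      ext j
      simp only [Pi.add_apply, mul_add, Finset.sum_add_distrib, PiLp.add_apply]
      push_cast; ring)
    (fun c θ x => by
      ext j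
      simp only [Pi.smul_apply, smul_eq_mul, PiLp.smul_apply, mul_left_comm _ c, ← Finset.mul_sum,
        Complex.real_smul]
      push_cast; ring)
    (fun θ x y => by
      ext j
      simp only [PiLp.add_apply]
      ring)
    (fun c θ x => by
      ext j
      simp only [PiLp.smul_apply, Complex.real_smul]
      ring)

omit [Fintype J] in
theorem diagonalGen_apply (θ : Fin m → ℝ) (x : PiLp 2 fun _ : J => ℂ) (j : J) :
    diagonalGen s θ x j = ((∑ p, s j p * θ p : ℝ) : ℂ) * Complex.I * x j := rfl

theorem diagonalGen_skew (θ : Fin m → ℝ) (x y : PiLp 2 fun _ : J => ℂ) :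
    inner ℝ (diagonalGen s θ x) y = - inner ℝ x (diagonalGen s θ y) := by
  rw [PiLp.inner_apply, PiLp.inner_apply, ← Finset.sum_neg_distrib]
  refine Finset.sum_congr rfl fun j _ => ?_
  rw [diagonalGen_apply, diagonalGen_apply, Complex.inner, Complex.inner, ← Complex.neg_re]
  congr 1
  simp only [map_mul, Complex.conj_ofReal, Complex.conj_I]
  ring

theorem hasDerivAt_diagonalAct {z : ℝ → Fin m → ℂ} {x : ℝ → PiLp 2 fun _ : J => ℂ} {t : ℝ}
    {θ : Fin m → ℝ} {y : PiLp 2 fun _ : J => ℂ}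
    (hz : HasDerivAt z (fun p => θ p * Complex.I * z t p) t) (hx : HasDerivAt x y t) :
    HasDerivAt (fun r => diagonalAct s (z r) (x r))
      (diagonalAct s (z t) (diagonalGen s θ (x t) + y)) t := by
  have hxj : ∀ j, HasDerivAt (fun r => x r j) (y j) t := fun j =>
    (PiLp.proj (𝕜 := ℝ) 2 (fun _ : J => ℂ) j).hasFDerivAt.comp_hasDerivAt t hx
  have h : HasDerivAt (fun r j => torusCharacter (s j) (z r) * x r j)
      (fun j => torusCharacter (s j) (z t) * (diagonalGen s θ (x t) + y) j) t := by
    rw [hasDerivAt_pi]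
    intro j
    refine ((hasDerivAt_torusCharacter (s j) hz).mul (hxj j)).congr_deriv ?_
    rw [PiLp.add_apply, diagonalGen_apply]
    ring
  exact (PiLp.continuousLinearEquiv 2 ℝ (fun _ : J => ℂ)).symm.hasFDerivAt.comp_hasDerivAt t h

variable {V : Type*} [NormedAddCommGroup V] [InnerProductSpace ℝ V]
  (K : (PiLp 2 fun _ : J => ℂ) →ₗᵢ[ℝ] V) (P : V →L[ℝ] PiLp 2 fun _ : J => ℂ)

/-- The diagonal action on an isometric copy of `ℂ^J` inside `V`, trivial on its complement. -/
noncomputable def extendedAct (z : Fin m → ℂ) (v : V) : V :=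
  (v - K (P v)) + K (diagonalAct s z (P v))

theorem contDiff_extendedAct :
    ContDiff ℝ ∞ fun q : (Fin m → ℂ) × V => extendedAct s K P q.1 q.2 := by
  have hP : ContDiff ℝ ∞ fun q : (Fin m → ℂ) × V => P q.2 := P.contDiff.comp contDiff_snd
  have hpair : ContDiff ℝ ∞ fun q : (Fin m → ℂ) × V => (q.1, P q.2) := contDiff_fst.prodMk hP
  have h : ContDiff ℝ ∞ fun q : (Fin m → ℂ) × V => diagonalAct s q.1 (P q.2) :=
    ContDiff.comp (g := fun q : (Fin m → ℂ) × PiLp 2 (fun _ : J => ℂ) => diagonalAct s q.1 q.2)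
      (f := fun q : (Fin m → ℂ) × V => (q.1, P q.2)) (contDiff_diagonalAct s) hpair
  have hKP : ContDiff ℝ ∞ fun q : (Fin m → ℂ) × V => K (P q.2) := K.contDiff.comp hP
  have hK : ContDiff ℝ ∞ fun q : (Fin m → ℂ) × V => K (diagonalAct s q.1 (P q.2)) :=
    K.contDiff.comp h
  exact (contDiff_snd.sub hKP).add hK

variable {K P}

/-- The hypothesis says that `P` is the adjoint of `K`; hence `K ∘ P` is the orthogonal projection
onto the copy of `ℂ^J`. -/
theorem LinearIsometry.apply_apply_of_adjoint (hP : ∀ v x, inner ℝ (K x) v = inner ℝ x (P v))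
    (x : PiLp 2 fun _ : J => ℂ) : P (K x) = x :=
  ext_inner_left ℝ fun y => by rw [← hP, K.inner_map_map]

theorem inner_extendedAct (hP : ∀ v x, inner ℝ (K x) v = inner ℝ x (P v)) {z : Fin m → ℂ}
    (hz : ∀ p, ‖z p‖ = 1) (v w : V) :
    inner ℝ (extendedAct s K P z v) (extendedAct s K P z w) = inner ℝ v w := by
  have hPK := LinearIsometry.apply_apply_of_adjoint hP
  have h1 : ∀ v x, inner ℝ (K x) (v - K (P v)) = 0 := by
    intro v x
    rw [hP, map_sub, hPK, sub_self, inner_zero_right]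
  have h2 : inner ℝ (v - K (P v)) (w - K (P w)) = inner ℝ v w - inner ℝ (P v) (P w) := by
    rw [inner_sub_left, h1, sub_zero, inner_sub_right, real_inner_comm (K (P w)) v, hP,
      real_inner_comm (P w)]
  rw [extendedAct, extendedAct, inner_add_left, inner_add_right, inner_add_right, h1,
    real_inner_comm (K _) (v - _), h1, K.inner_map_map, inner_diagonalAct s hz, h2]
  ring

theorem hasDerivAt_extendedAct (hP : ∀ v x, inner ℝ (K x) v = inner ℝ x (P v))
    {z : ℝ → Fin m → ℂ} {v : ℝ → V} {t : ℝ} {θ : Fin m → ℝ} {w : V}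
    (hz : HasDerivAt z (fun p => θ p * Complex.I * z t p) t) (hv : HasDerivAt v w t) :
    HasDerivAt (fun r => extendedAct s K P (z r) (v r))
      (extendedAct s K P (z t) (K (diagonalGen s θ (P (v t))) + w)) t := by
  have hPK := LinearIsometry.apply_apply_of_adjoint hP
  have hPv : HasDerivAt (fun r => P (v r)) (P w) t := P.hasFDerivAt.comp_hasDerivAt t hv
  have h1 : HasDerivAt (fun r => K (diagonalAct s (z r) (P (v r))))
      (K (diagonalAct s (z t) (diagonalGen s θ (P (v t)) + P w))) t :=
    K.toContinuousLinearMap.hasFDerivAt.comp_hasDerivAt t (hasDerivAt_diagonalAct s hz hPv)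
  have h2 : HasDerivAt (fun r => v r - K (P (v r))) (w - K (P w)) t :=
    hv.sub (K.toContinuousLinearMap.hasFDerivAt.comp_hasDerivAt t hPv)
  refine (h2.add h1).congr_deriv ?_
  rw [extendedAct, map_add P, hPK, map_add K]
  abel

variable (K) in
/-- The diagonal action on an isometric copy of `ℂ^J` inside `V`, trivial on its complement. -/
noncomputable def diagonalTorusAction [CompleteSpace V] : TorusAction m V :=
  have hP : ∀ v x, inner ℝ (K x) v =
      inner ℝ x (ContinuousLinearMap.adjoint K.toContinuousLinearMap v) := fun v x =>
    (ContinuousLinearMap.adjoint_inner_right K.toContinuousLinearMap x v).symm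
  { act := extendedAct s K (ContinuousLinearMap.adjoint K.toContinuousLinearMap)
    gen := ((diagonalGen s).compl₂
      (ContinuousLinearMap.adjoint K.toContinuousLinearMap).toLinearMap).compr₂ K.toLinearMap
    contDiff_act := contDiff_extendedAct s K _
    inner_act := fun _ hz => inner_extendedAct s hP hz
    hasDerivAt_act := fun _ _ _ _ _ _ hz hv => hasDerivAt_extendedAct s hP hz hv
    gen_skew := fun θ v w => by
      change inner ℝ (K (diagonalGen s θ (ContinuousLinearMap.adjoint K.toContinuousLinearMap v))) w
        = - inner ℝ v (K (diagonalGen s θ (ContinuousLinearMap.adjoint K.toContinuousLinearMap w)))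
      rw [hP, diagonalGen_skew, real_inner_comm _ v, hP,
        real_inner_comm (ContinuousLinearMap.adjoint K.toContinuousLinearMap v)] }

theorem diagonalTorusAction_gen_apply [CompleteSpace V] (θ : Fin m → ℝ)
    (x : PiLp 2 fun _ : J => ℂ) :
    (diagonalTorusAction s K).gen θ (K x) = K (diagonalGen s θ x) := by
  have h := LinearIsometry.apply_apply_of_adjoint (K := K)
    (P := ContinuousLinearMap.adjoint K.toContinuousLinearMap) (fun v x =>
    (ContinuousLinearMap.adjoint_inner_right K.toContinuousLinearMap x v).symm) x
  change K (diagonalGen s θ (ContinuousLinearMap.adjoint K.toContinuousLinearMap (K x))) = _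
  rw [h]

end Diagonal

/-! ### Assembling the immersion -/

theorem LinearIsometry.nonempty_of_finrank_le {E V : Type*} [NormedAddCommGroup E]
    [InnerProductSpace ℝ E] [FiniteDimensional ℝ E] [NormedAddCommGroup V] [InnerProductSpace ℝ V]
    [FiniteDimensional ℝ V] (h : Module.finrank ℝ E ≤ Module.finrank ℝ V) :
    Nonempty (E →ₗᵢ[ℝ] V) := by
  set b := stdOrthonormalBasis ℝ E
  set b' := stdOrthonormalBasis ℝ V
  refine ⟨(b.toBasis.constr ℝ (b' ∘ Fin.castLE h)).isometryOfOrthonormal (v := b.toBasis)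
    (by simp) ?_⟩
  have : (b.toBasis.constr ℝ (b' ∘ Fin.castLE h)) ∘ b.toBasis = b' ∘ Fin.castLE h := by
    funext i
    exact b.toBasis.constr_basis ℝ _ i
  rw [this]
  exact b'.orthonormal.comp _ (Fin.castLE_injective h)

/-- Supplies the normal frame `L` of the orbit, `T` being `ξ ↦ ξa`. -/
theorem exists_orthogonal_linearIsometry {E V : Type*} [AddCommGroup E] [Module ℝ E]
    [NormedAddCommGroup V] [InnerProductSpace ℝ V] [FiniteDimensional ℝ V] (T : E →ₗ[ℝ] V)
    (hT : Function.Injective T) {n : ℕ} (h : Module.finrank ℝ E + n = Module.finrank ℝ V) :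
    ∃ L : EuclideanSpace ℝ (Fin n) →ₗᵢ[ℝ] V, ∀ x u, inner ℝ (T x) (L u) = 0 := by
  have h1 : Module.finrank ℝ (LinearMap.range T)ᗮ = n := by
    have h2 := (LinearMap.range T).finrank_add_finrank_orthogonal
    rw [LinearMap.finrank_range_of_inj hT] at h2
    omega
  obtain ⟨L⟩ := LinearIsometry.nonempty_of_finrank_le (E := EuclideanSpace ℝ (Fin n))
    (V := ((LinearMap.range T)ᗮ : Submodule ℝ V)) (by rw [h1]; simp)
  exact ⟨(LinearMap.range T)ᗮ.subtypeₗᵢ.comp L, fun x u => (L u).2 _ ⟨x, rfl⟩⟩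

theorem norm_sq_diagonalGen {m : ℕ} {J : Type*} [Fintype J] (s : J → Fin m → ℤ) (ξ : Fin m → ℝ)
    {w : J → ℝ} (hw : ∀ j, 0 ≤ w j) :
    ‖diagonalGen s ξ (WithLp.toLp 2 fun j => (√(w j) : ℂ))‖ ^ 2 =
      ∑ j, w j * (∑ p, s j p * ξ p) ^ 2 := by
  rw [PiLp.norm_sq_eq_of_L2]
  refine Finset.sum_congr rfl fun j _ => ?_
  rw [diagonalGen_apply, norm_mul, norm_mul, Complex.norm_I, Complex.norm_real, Complex.norm_real,
    mul_one, mul_pow, Real.norm_eq_abs, Real.norm_eq_abs, sq_abs, sq_abs, Real.sq_sqrt (hw j),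
    mul_comm]

theorem norm_sq_diagonalGen_diagonalGen {m : ℕ} {J : Type*} [Fintype J] (s : J → Fin m → ℤ)
    (ξ : Fin m → ℝ) {w : J → ℝ} (hw : ∀ j, 0 ≤ w j) :
    ‖diagonalGen s ξ (diagonalGen s ξ (WithLp.toLp 2 fun j => (√(w j) : ℂ)))‖ ^ 2 =
      ∑ j, w j * (∑ p, s j p * ξ p) ^ 4 := by
  rw [PiLp.norm_sq_eq_of_L2]
  refine Finset.sum_congr rfl fun j _ => ?_
  rw [diagonalGen_apply, diagonalGen_apply, norm_mul, norm_mul, norm_mul, norm_mul, Complex.norm_I,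
    Complex.norm_real, Complex.norm_real, mul_one, mul_pow, mul_pow, Real.norm_eq_abs,
    Real.norm_eq_abs, sq_abs, sq_abs, Real.sq_sqrt (hw j)]
  ring

theorem exists_immersion_sphere_prod_torus (k m : ℕ) (hk : (m + 1) ^ (m + 1) ^ 4 ≤ k) :
    ∃ F : UnitSphere k × Torus m → EuclideanSpace ℝ (Fin (k + (m + 1))),
      IsSmoothImmersion ((𝓡 k).prod (torusModel m)) F ∧
      Set.range F ⊆ Metric.closedBall 0 1 ∧
      normalCurvature ((𝓡 k).prod (torusModel m)) F ≤
        ENNReal.ofReal (1 + 2 * √(3 * m / (m + 2))) := by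
  obtain ⟨s, w, hw, hw1, hQ, hQ0⟩ := exists_integral_design m
  obtain ⟨K⟩ := LinearIsometry.nonempty_of_finrank_le
    (E := PiLp 2 fun _ : ((Fin m → Bool) × Fin m) ⊕ Fin m => ℂ)
    (V := EuclideanSpace ℝ (Fin (k + (m + 1)))) (by
      have h1 : Module.finrank ℝ (PiLp 2 fun _ : ((Fin m → Bool) × Fin m) ⊕ Fin m => ℂ) =
          Fintype.card (((Fin m → Bool) × Fin m) ⊕ Fin m) * 2 := by
        rw [(WithLp.linearEquiv 2 ℝ _).finrank_eq, Module.finrank_pi_fintype]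
        simp only [Complex.finrank_real_complex, Finset.sum_const, Finset.card_univ, smul_eq_mul]
      rw [h1, finrank_euclideanSpace_fin]
      have := two_mul_card_design_le (m := m)
      omega)
  set c := √(3 * (m : ℝ) / (m + 2)) with hc
  set a₀ : PiLp 2 fun _ : ((Fin m → Bool) × Fin m) ⊕ Fin m => ℂ :=
    WithLp.toLp 2 fun j => (√(w j) : ℂ) with ha₀
  set A := diagonalTorusAction s K
  have hgen : ∀ ξ, ‖A.gen ξ (A.gen ξ (K a₀))‖ ≤ c * ‖A.gen ξ (K a₀)‖ ^ 2 := by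
    intro ξ
    rw [diagonalTorusAction_gen_apply, diagonalTorusAction_gen_apply, K.norm_map, K.norm_map]
    refine le_of_sq_le_sq ?_ (by positivity)
    rw [norm_sq_diagonalGen_diagonalGen s ξ hw, norm_sq_diagonalGen s ξ hw, mul_pow, hc,
      Real.sq_sqrt (by positivity)]
    exact hQ ξ
  have hfree : ∀ ξ, A.gen ξ (K a₀) = 0 → ξ = 0 := by
    intro ξ h
    rw [diagonalTorusAction_gen_apply, ← norm_eq_zero, K.norm_map] at h
    apply hQ0
    rw [← norm_sq_diagonalGen s ξ hw, h, zero_pow two_ne_zero]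
  -- By `hfree` the orbit has an `m`-dimensional tangent space, which leaves `k + 1` of the `k + m +
  -- 1` dimensions for the normal sphere `S^k`.
  obtain ⟨L, horth⟩ := exists_orthogonal_linearIsometry (A.gen.flip (K a₀))
    ((injective_iff_map_eq_zero _).2 hfree) (n := k + 1) (by
      rw [finrank_euclideanSpace_fin]; simp; ring)
  have ha : ‖K a₀‖ ≤ 1 := by
    rw [K.norm_map, ← sq_le_one_iff₀ (norm_nonneg _), PiLp.norm_sq_eq_of_L2]
    refine le_trans (le_of_eq (Finset.sum_congr rfl fun j _ => ?_)) hw1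
    rw [ha₀, Complex.norm_real, Real.norm_eq_abs, sq_abs, Real.sq_sqrt (hw j)]
  have hc0 : 0 ≤ c := Real.sqrt_nonneg _
  exact ⟨A.tubeMap (K a₀) L c, A.isSmoothImmersion_tubeMap hc0 horth hgen hfree,
    A.range_tubeMap_subset hc0 ha,
    A.normalCurvature_tubeMap_le hc0 (by rw [finrank_euclideanSpace_fin]; ring) horth hgen hfree⟩

theorem mainTheorem5 (k l : ℕ) (hl : 1 ≤ l) (hk : l ^ (l ^ 4) ≤ k) :
    (∃ F : UnitSphere k × Torus (l - 1) → EuclideanSpace ℝ (Fin (k + l)),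
      IsSmoothImmersion ((𝓡 k).prod (torusModel (l - 1))) F ∧
      Set.range F ⊆ Metric.closedBall 0 1 ∧
      normalCurvature ((𝓡 k).prod (torusModel (l - 1))) F ≤
        ENNReal.ofReal (1 + 2 * √((3 * (l : ℝ) - 3) / ((l : ℝ) + 1)))) ∧
    1 + 2 * √((3 * (l : ℝ) - 3) / ((l : ℝ) + 1)) < 4.5 := by
  constructor
  · obtain ⟨m, rfl⟩ : ∃ m, l = m + 1 := ⟨l - 1, by omega⟩
    have h : (3 * ((m + 1 : ℕ) : ℝ) - 3) / (((m + 1 : ℕ) : ℝ) + 1) = 3 * m / (m + 2) := by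
      push_cast
      congr 1 <;> ring
    rw [h]
    exact exists_immersion_sphere_prod_torus k m hk
  · have h : √((3 * (l : ℝ) - 3) / ((l : ℝ) + 1)) < 1.75 := by
      rw [Real.sqrt_lt' (by norm_num), div_lt_iff₀ (by positivity)]
      have : (0 : ℝ) ≤ l := Nat.cast_nonneg l
      norm_num
      linarith
    norm_num at h ⊢
    linarith
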